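/- Let $k\ge 0$ be an integer and let $q,z\in\mathbb{C}$ with $0<|q|<1$ and $z\neq 0$. Write $(A;q)_n=\prod_{i=0}^{n-1}(1-Aq^i)$, $(A;q)_\infty=\prod_{i=0}^{\infty}(1-Aq^i)$, $(A)_n=(A;q)_n$, and $(A,B,C;q)_\infty=(A;q)_\infty(B;q)_\infty(C;q)_\infty$. Then $$ \sum_{s_1\ge s_2\ge\cdots\ge s_{k+1}\ge 0} \frac{q^{s_1^2+\cdots+s_{k+1}^2+s_1+\cdots+s_{k+1}}}{(q)_{s_1-s_2}\cdots(q)_{s_k-s_{k+1}}}\, \frac{(-zq^{k+1})_{s_{k+1}+1}\,(-q^{-k}/z)_{s_{k+1}}}{(q)_{2s_{k+1}+1}} =\frac{(-zq^{k+1},\,-q^{k+2}/z,\,q^{2k+3};\,q^{2k+3})_\infty}{(q;q)_\infty}, $$ where the sum runs over all integer sequences $s_1\ge\cdots\ge s_{k+1}\ge 0$ and converges absolutely. -/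

import Mathlib

open scoped BigOperators

/-- The finite `q`-Pochhammer symbol `(a; q)_n = ∏_{i < n} (1 - a q^i)`. -/
noncomputable def qPoch (a q : ℂ) (n : ℕ) : ℂ :=
  ∏ i ∈ Finset.range n, (1 - a * q ^ i)

/-- The infinite `q`-Pochhammer symbol `(a; q)_∞ = ∏_{i ≥ 0} (1 - a q^i)`. -/
noncomputable def qPochInf (a q : ℂ) : ℂ :=
  ∏' i : ℕ, (1 - a * q ^ i)

/-- For `|q| < 1` the finite symbols converge to the infinite one, so `qPochInf` is the genuine
infinite product. -/
theorem tendsto_qPoch (a : ℂ) {q : ℂ} (hq : ‖q‖ < 1) :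
    Filter.Tendsto (fun n => qPoch a q n) Filter.atTop (nhds (qPochInf a q)) := by
  have hs : Summable fun i : ℕ => ‖-(a * q ^ i)‖ := by
    simp only [norm_neg, norm_mul, norm_pow]
    exact (summable_geometric_of_lt_one (norm_nonneg q) hq).mul_left _
  have hm : Multipliable fun i : ℕ => 1 - a * q ^ i := by
    simpa [sub_eq_add_neg] using multipliable_one_add_of_summable hs
  exact hm.hasProd.tendsto_prod_nat

/-- The summation range `s_1 ≥ s_2 ≥ ⋯ ≥ s_{k+1} ≥ 0`; the index `i : Fin (k + 1)` stands for
the subscript `i + 1`. -/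
abbrev Chain (k : ℕ) : Type := {s : Fin (k + 1) → ℕ // Antitone s}

/-- The summand
`q^{s_1^2 + ⋯ + s_{k+1}^2 + s_1 + ⋯ + s_{k+1}} (-z q^{k+1}; q)_{s_{k+1}+1} (-q^{-k}/z; q)_{s_{k+1}}`
divided by `(q)_{s_1 - s_2} ⋯ (q)_{s_k - s_{k+1}} (q)_{2 s_{k+1} + 1}`. -/
noncomputable def oddTerm (k : ℕ) (q z : ℂ) (s : Chain k) : ℂ :=
  q ^ (∑ i, (s.1 i ^ 2 + s.1 i)) /
      (∏ i : Fin k, qPoch q q (s.1 i.castSucc - s.1 i.succ)) *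
    (qPoch (-(z * q ^ (k + 1))) q (s.1 (Fin.last k) + 1) *
        qPoch (-(q ^ (-(k : ℤ)) / z)) q (s.1 (Fin.last k)) /
      qPoch q q (2 * s.1 (Fin.last k) + 1))

/-! This is a Bailey chain argument. With `w = z * q ^ (k + 1)`, the finite Jacobi triple product
(`hasSum_finite_triple_product`, sizes `n` and `n + 1`) expands the last factor as ∑ⱼ q^(j(j-1)/2)
w^j / ((q)_{n+j} (q)_{n+1-j}). Summing such an expansion against q^(n²+n) / (q)_{M-n} preserves its
shape and multiplies the j-th coefficient by q^(j(j-1)) (`baileyOp_baileySum`, from q-Vandermonde).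
The variables s_{k+1}, …, s_2 give k such steps; s_1 gives a last one with M → ∞
(`tsum_mul_baileySum`). What remains is ∑ⱼ q^((2k+3)j(j-1)/2) w^j / (q)_∞, and the Jacobi triple
product in base q^(2k+3) evaluates it. -/

open Filter Topology

/-! ### Reciprocal q-factorials on ℤ. -/

/-- The reciprocal `1 / (q; q)_m`, extended by zero to negative integers `m`. -/
noncomputable def invPoch (q : ℂ) (m : ℤ) : ℂ :=
  if m < 0 then 0 else (qPoch q q m.toNat)⁻¹

/-- The binomial coefficient `j (j - 1) / 2` of an integer `j`. -/
def tri (j : ℤ) : ℤ := j * (j - 1) / 2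

theorem two_mul_tri (j : ℤ) : 2 * tri j = j * (j - 1) :=
  Int.mul_ediv_cancel' (Int.even_mul_pred_self j).two_dvd

theorem tri_add_one (j : ℤ) : tri (j + 1) = tri j + j := by
  have h1 := two_mul_tri j
  have h2 := two_mul_tri (j + 1)
  linarith

theorem tri_sub_one (j : ℤ) : tri (j - 1) = tri j - (j - 1) := by
  have h := tri_add_one (j - 1)
  rw [sub_add_cancel] at h
  linarith

theorem tri_zero : tri 0 = 0 := rfl

theorem invPoch_of_neg (q : ℂ) {m : ℤ} (hm : m < 0) : invPoch q m = 0 := if_pos hm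

theorem invPoch_natCast (q : ℂ) (n : ℕ) : invPoch q n = (qPoch q q n)⁻¹ := by
  simp [invPoch]

theorem invPoch_zero (q : ℂ) : invPoch q 0 = 1 := by
  simp [invPoch, qPoch]

theorem qPoch_succ (a q : ℂ) (n : ℕ) : qPoch a q (n + 1) = qPoch a q n * (1 - a * q ^ n) :=
  Finset.prod_range_succ _ _

theorem one_sub_pow_succ_ne_zero {q : ℂ} (hq : ‖q‖ < 1) (n : ℕ) : 1 - q ^ (n + 1) ≠ 0 := by
  intro h
  have h1 : ‖q ^ (n + 1)‖ = 1 := by rw [← sub_eq_zero.mp h, norm_one]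
  rw [norm_pow] at h1
  exact (pow_lt_one₀ (norm_nonneg q) hq n.succ_ne_zero).ne h1

/-- Extension by zero makes this recurrence hold at every integer; at `m = 0` both sides vanish.
Sums over j can then run over all of ℤ. -/
theorem one_sub_zpow_mul_invPoch {q : ℂ} (hq : ‖q‖ < 1) (m : ℤ) :
    (1 - q ^ m) * invPoch q m = invPoch q (m - 1) := by
  rcases lt_trichotomy m 0 with hm | rfl | hm
  · rw [invPoch_of_neg q hm, invPoch_of_neg q (by omega), mul_zero]
  · simp [invPoch_of_neg]
  · obtain ⟨n, rfl⟩ : ∃ n : ℕ, m = n + 1 := ⟨(m - 1).toNat, by omega⟩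
    have h := one_sub_pow_succ_ne_zero hq n
    rw [add_sub_cancel_right, invPoch_natCast]
    have h2 := invPoch_natCast q (n + 1)
    push_cast at h2
    rw [h2, qPoch_succ, mul_inv, ← pow_succ']
    have h3 : q ^ ((n : ℤ) + 1) = q ^ (n + 1) := by exact_mod_cast zpow_natCast q (n + 1)
    rw [h3, mul_left_comm, mul_inv_cancel₀ h, mul_one]

/-- The common form of the two `q`-Pascal rules. -/
theorem one_sub_zpow_add_mul_invPoch_mul_invPoch {q : ℂ} (hq0 : q ≠ 0) (hq : ‖q‖ < 1) (m n : ℤ) :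
    (1 - q ^ (m + n)) * (invPoch q m * invPoch q n) =
      invPoch q (m - 1) * invPoch q n + q ^ m * (invPoch q m * invPoch q (n - 1)) := by
  rw [← one_sub_zpow_mul_invPoch hq m, ← one_sub_zpow_mul_invPoch hq n, zpow_add₀ hq0]
  ring

theorem tendsto_invPoch {q : ℂ} (hq : ‖q‖ < 1) (h0 : qPochInf q q ≠ 0) :
    Tendsto (invPoch q) atTop (𝓝 (qPochInf q q)⁻¹) := by
  have h1 : Tendsto (fun m : ℤ => m.toNat) atTop atTop :=
    tendsto_atTop.2 fun b => by
      filter_upwards [eventually_ge_atTop (b : ℤ)] with m hm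
      omega
  refine (((tendsto_qPoch q hq).comp h1).inv₀ h0).congr' ?_
  filter_upwards [eventually_ge_atTop (0 : ℤ)] with m hm
  simp [invPoch, hm.not_gt]

theorem qPochInf_self_ne_zero {q : ℂ} (hq : ‖q‖ < 1) : qPochInf q q ≠ 0 := by
  have h := tprod_one_add_ne_zero_of_summable (R := ℂ) (f := fun i : ℕ => -(q * q ^ i)) ?_ ?_
  · simpa [qPochInf, sub_eq_add_neg] using h
  · intro i
    rw [← pow_succ', ← sub_eq_add_neg]
    exact one_sub_pow_succ_ne_zero hq i
  · simp only [norm_neg, norm_mul, norm_pow]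
    exact (summable_geometric_of_lt_one (norm_nonneg q) hq).mul_left _

theorem exists_norm_invPoch_le {q : ℂ} (hq : ‖q‖ < 1) : ∃ C, ∀ m, ‖invPoch q m‖ ≤ C := by
  obtain ⟨C, hC⟩ := ((tendsto_qPoch q hq).inv₀ (qPochInf_self_ne_zero hq)).norm.bddAbove_range
  refine ⟨C, fun m => ?_⟩
  rcases lt_or_ge m 0 with hm | hm
  · rw [invPoch_of_neg q hm, norm_zero]
    exact (norm_nonneg _).trans (hC ⟨0, rfl⟩)
  · lift m to ℕ using hm
    rw [invPoch_natCast]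
    exact hC ⟨m, rfl⟩

theorem HasSum.int_shift {f : ℤ → ℂ} {s : ℂ} (h : HasSum f s) (d : ℤ) :
    HasSum (fun j => f (j + d)) s :=
  (Equiv.addRight d).hasSum_iff.2 h

theorem HasSum.of_mul_left {ι : Type*} {f : ι → ℂ} {s c t : ℂ} (hc : c ≠ 0)
    (h : HasSum (fun i => c * f i) s) (hs : s = c * t) : HasSum f t := by
  subst hs
  exact (hasSum_mul_left_iff hc).1 h

/-! ### Finite triple product and q-Vandermonde. -/

theorem hasSum_finite_triple_product {q w : ℂ} (hq0 : q ≠ 0) (hq : ‖q‖ < 1) (hw : w ≠ 0)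
    (a b : ℕ) :
    HasSum (fun j : ℤ => q ^ tri j * w ^ j * (invPoch q (a + j) * invPoch q (b - j)))
      (qPoch (-w) q b * qPoch (-(q / w)) q a * invPoch q (a + b)) := by
  induction b with
  | zero =>
    induction a with
    | zero =>
      convert hasSum_single (0 : ℤ) ?_ using 1
      · simp [qPoch, invPoch_zero, tri_zero]
      · intro j hj
        rcases lt_or_gt_of_ne hj with h | h
        · rw [invPoch_of_neg q (m := (0 : ℕ) + j) (by simpa using h)]; simp
        · rw [invPoch_of_neg q (m := (0 : ℕ) - j) (by simpa using h)]; simp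
    | succ a ih =>
      -- After multiplication by 1 - q^(a+1), the Pascal rule splits each term into the old term and
      -- a multiple of the old term shifted in j.
      refine HasSum.of_mul_left (one_sub_pow_succ_ne_zero hq a)
        (s := (1 + q / w * q ^ a) *
          (qPoch (-w) q 0 * qPoch (-(q / w)) q a * invPoch q (a + (0 : ℕ)))) ?_ ?_
      · convert ih.add ((ih.int_shift 1).mul_left (q / w * q ^ a)) using 1
        · ext j
          have h := one_sub_zpow_add_mul_invPoch_mul_invPoch hq0 hq (a + 1 + j) ((0 : ℕ) - j)
          have e1 : (a + 1 + j + ((0 : ℕ) - j) : ℤ) = ((a + 1 : ℕ) : ℤ) := by push_cast; ring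
          rw [e1, zpow_natCast] at h
          have e2 : (a + 1 + j - 1 : ℤ) = a + j := by ring
          have e3 : ((a + 1 : ℕ) + j : ℤ) = a + 1 + j := by push_cast; ring
          have e4 : (a + (j + 1) : ℤ) = a + 1 + j := by ring
          have e5 : ((0 : ℕ) - (j + 1) : ℤ) = (0 : ℕ) - j - 1 := by ring
          rw [e3, e4, e5, mul_left_comm, h, e2, tri_add_one]
          simp only [zpow_add₀ hq0, zpow_add₀ hw, zpow_natCast, zpow_one]
          field_simp
        · ring
      · have h := one_sub_zpow_mul_invPoch hq ((a + 1 : ℕ) + (0 : ℕ))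
        have e1 : ((a + 1 : ℕ) + (0 : ℕ) : ℤ) = ((a + 1 : ℕ) : ℤ) := by push_cast; ring
        have e2 : (((a + 1 : ℕ) : ℤ) - 1 : ℤ) = a + (0 : ℕ) := by push_cast; ring
        rw [e1, e2, zpow_natCast] at h
        rw [e1, qPoch_succ, ← h]
        ring
  | succ b ih =>
    refine HasSum.of_mul_left (one_sub_pow_succ_ne_zero hq (a + b))
      (s := (1 + w * q ^ b) * (qPoch (-w) q b * qPoch (-(q / w)) q a * invPoch q (a + b))) ?_ ?_
    · convert ih.add ((ih.int_shift (-1)).mul_left (w * q ^ b)) using 1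
      · ext j
        have h := one_sub_zpow_add_mul_invPoch_mul_invPoch hq0 hq (b + 1 - j) (a + j)
        have e1 : (b + 1 - j + (a + j) : ℤ) = ((a + b + 1 : ℕ) : ℤ) := by push_cast; ring
        rw [e1, zpow_natCast] at h
        have e2 : (b + 1 - j - 1 : ℤ) = b - j := by ring
        have e3 : ((b + 1 : ℕ) - j : ℤ) = b + 1 - j := by push_cast; ring
        have e4 : (a + (j + -1) : ℤ) = a + j - 1 := by ring
        have e5 : (b - (j + -1) : ℤ) = b + 1 - j := by ring
        rw [e3, e4, e5, mul_left_comm, mul_comm (invPoch q (a + j)), h, e2, ← sub_eq_add_neg,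
          tri_sub_one]
        simp only [zpow_add₀ hq0, zpow_sub₀ hq0, zpow_sub₀ hw, zpow_natCast, zpow_one]
        field_simp
      · ring
    · have h := one_sub_zpow_mul_invPoch hq (a + (b + 1 : ℕ))
      have e1 : (a + (b + 1 : ℕ) : ℤ) = ((a + b + 1 : ℕ) : ℤ) := by push_cast; ring
      have e2 : (((a + b + 1 : ℕ) : ℤ) - 1 : ℤ) = a + b := by push_cast; ring
      rw [e1, e2, zpow_natCast] at h
      rw [e1, qPoch_succ, ← h]
      ring

/-- Induction on `N` by the Pascal rule; `c` stays general because the shifted half is the sum for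
`c + 1`. -/
theorem hasSum_vandermonde {q : ℂ} (hq0 : q ≠ 0) (hq : ‖q‖ < 1) (N : ℕ) (c : ℤ) :
    HasSum (fun m : ℤ => q ^ (m * (m + c)) * (invPoch q (N - m) * invPoch q m * invPoch q (m + c)))
      (invPoch q N * invPoch q (N + c)) := by
  induction N generalizing c with
  | zero =>
    convert hasSum_single (0 : ℤ) ?_ using 1
    · simp [invPoch_zero]
    · intro j hj
      rcases lt_or_gt_of_ne hj with h | h
      · rw [invPoch_of_neg q h]; simp
      · rw [invPoch_of_neg q (m := (0 : ℕ) - j) (by simpa using h)]; simp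
  | succ N ih =>
    refine HasSum.of_mul_left (one_sub_pow_succ_ne_zero hq N)
      (s := invPoch q N * invPoch q (N + c) +
        q ^ (N + c + 1) * (invPoch q N * invPoch q (N + (c + 1)))) ?_ ?_
    · convert (ih c).add (((ih (c + 1)).int_shift (-1)).mul_left (q ^ (N + c + 1))) using 1
      ext m
      have h := one_sub_zpow_add_mul_invPoch_mul_invPoch hq0 hq (N + 1 - m) m
      have e1 : (N + 1 - m + m : ℤ) = ((N + 1 : ℕ) : ℤ) := by push_cast; ring
      have e2 : (N + 1 - m - 1 : ℤ) = N - m := by ring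
      have e3 : ((N + 1 : ℕ) - m : ℤ) = N + 1 - m := by push_cast; ring
      have e4 : (N - (m + -1) : ℤ) = N + 1 - m := by ring
      have e5 : (m + -1 + (c + 1) : ℤ) = m + c := by ring
      have e6 : q ^ ((N : ℤ) + c + 1) * q ^ ((m + -1) * (m + c)) =
          q ^ (m * (m + c)) * q ^ (N + 1 - m : ℤ) := by
        rw [← zpow_add₀ hq0, ← zpow_add₀ hq0]
        congr 1
        ring
      rw [e1, zpow_natCast, e2] at h
      rw [e3, e4, e5, ← mul_assoc (q ^ ((N : ℤ) + c + 1)), e6, ← sub_eq_add_neg]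
      linear_combination q ^ (m * (m + c)) * invPoch q (m + c) * h
    · have h := one_sub_zpow_mul_invPoch hq (N + c + 1)
      have h' := one_sub_zpow_mul_invPoch hq (N + 1 : ℕ)
      have e1 : (N + c + 1 - 1 : ℤ) = N + c := by ring
      have e2 : ((N + 1 : ℕ) - 1 : ℤ) = N := by push_cast; ring
      have e3 : ((N + 1 : ℕ) + c : ℤ) = N + c + 1 := by push_cast; ring
      rw [e1] at h
      rw [e2, zpow_natCast] at h'
      rw [e3, ← add_assoc (N : ℤ)]
      linear_combination -invPoch q N * h - invPoch q (N + c + 1) * h'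

/-! ### The Bailey chain. -/

/-- The limiting Bailey lemma for the base `a = q`, on a single summand of a Bailey pair. -/
theorem hasSum_bailey_term {q : ℂ} (hq0 : q ≠ 0) (hq : ‖q‖ < 1) (M : ℕ) (j : ℤ) :
    HasSum (fun n : ℕ => q ^ (n ^ 2 + n) * invPoch q (M - n) *
        (invPoch q (n + j) * invPoch q (n + 1 - j)))
      (q ^ (2 * tri j) * (invPoch q (M + j) * invPoch q (M + 1 - j))) := by
  rcases lt_or_ge (M + j : ℤ) 0 with h | h
  · rw [invPoch_of_neg q h]
    convert hasSum_zero using 1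
    · ext n
      rcases lt_or_ge (M : ℤ) n with hn | hn
      · rw [invPoch_of_neg q (m := M - n) (by omega)]; simp
      · rw [invPoch_of_neg q (m := n + j) (by omega)]; simp
    · simp
  · obtain ⟨N, hN⟩ := Int.eq_ofNat_of_zero_le h
    -- Vandermonde with m = n + j, N = M + j, c = 1 - 2j; the exponents match since (n+j)(n+1-j) =
    -- n² + n - j(j-1).
    have hv := ((hasSum_vandermonde hq0 hq N (1 - 2 * j)).int_shift j).mul_left (q ^ (2 * tri j))
    rw [← hN] at hv
    have e1 : (M + j + (1 - 2 * j) : ℤ) = M + 1 - j := by ring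
    rw [e1, ← Nat.cast_injective.hasSum_iff (g := ((↑) : ℕ → ℤ))] at hv
    · refine (congrArg (HasSum · _) (funext fun n => ?_)).mpr hv
      have e2 : (M + j - (n + j) : ℤ) = M - n := by ring
      have e3 : (n + j + (1 - 2 * j) : ℤ) = n + 1 - j := by ring
      have e4 : q ^ (n ^ 2 + n) = q ^ (2 * tri j) * q ^ ((n + j) * (n + 1 - j)) := by
        rw [← zpow_add₀ hq0, ← zpow_natCast, two_mul_tri]
        congr 1
        push_cast
        ring
      simp only [Function.comp_apply]
      rw [e2, e3, e4]
      ring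
    -- For n < 0 the indices n + j and n + 1 - j have sum 2n + 1 < 0, so one is negative and the
    -- term vanishes.
    · intro n hn
      have hn0 : n < 0 := by
        by_contra h0
        exact hn ⟨n.toNat, by omega⟩
      rcases lt_or_ge (n + j) 0 with h1 | h1
      · rw [invPoch_of_neg q h1]; simp
      · rw [invPoch_of_neg q (m := n + j + (1 - 2 * j)) (by omega)]; simp

/-- The operator `f ↦ (M ↦ ∑ₙ q^(n² + n) f(n) / (q)_{M - n})` on sequences. -/
noncomputable def baileyOp (q : ℂ) (f : ℕ → ℂ) (M : ℕ) : ℂ :=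
  ∑' n : ℕ, q ^ (n ^ 2 + n) * invPoch q (M - n) * f n

/-- The sequence `n ↦ ∑ⱼ a(j) / ((q)_{n + j} (q)_{n + 1 - j})`. -/
noncomputable def baileySum (q : ℂ) (a : ℤ → ℂ) (n : ℕ) : ℂ :=
  ∑' j : ℤ, a j * (invPoch q (n + j) * invPoch q (n + 1 - j))

theorem summable_baileySum (q : ℂ) (a : ℤ → ℂ) (n : ℕ) :
    Summable fun j : ℤ => a j * (invPoch q (n + j) * invPoch q (n + 1 - j)) := by
  refine summable_of_ne_finset_zero (s := Finset.Icc (-n : ℤ) (n + 1)) fun j hj => ?_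
  rcases lt_or_ge (n + j : ℤ) 0 with h | h
  · rw [invPoch_of_neg q h]; simp
  · rw [invPoch_of_neg q (m := n + 1 - j)]
    · simp
    · rw [Finset.mem_Icc] at hj; omega

theorem baileyOp_eq_sum (q : ℂ) (f : ℕ → ℂ) (M : ℕ) :
    baileyOp q f M =
      ∑ n ∈ Finset.range (M + 1), q ^ (n ^ 2 + n) * invPoch q (M - n) * f n := by
  refine tsum_eq_sum fun n hn => ?_
  rw [invPoch_of_neg q (m := M - n)]
  · simp
  · rw [Finset.mem_range] at hn; omega

/-- Both sums have finite support, so they can be interchanged for arbitrary `a`. -/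
theorem baileyOp_baileySum {q : ℂ} (hq0 : q ≠ 0) (hq : ‖q‖ < 1) (a : ℤ → ℂ) :
    baileyOp q (baileySum q a) = baileySum q fun j => q ^ (2 * tri j) * a j := by
  ext M
  rw [baileyOp_eq_sum]
  have h := hasSum_sum (s := Finset.range (M + 1)) fun n _ =>
    (summable_baileySum q a n).hasSum.mul_left (q ^ (n ^ 2 + n) * invPoch q (M - n))
  refine h.unique ?_
  refine (congrArg (HasSum · _) (funext fun j => ?_)).mpr
    (summable_baileySum q (fun j => q ^ (2 * tri j) * a j) M).hasSum
  have hs := (hasSum_bailey_term hq0 hq M j).unique (hasSum_sum_of_ne_finset_zero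
    (s := Finset.range (M + 1)) fun n hn => by
      rw [invPoch_of_neg q (m := M - n)]
      · simp
      · rw [Finset.mem_range] at hn; omega)
  rw [mul_right_comm (q ^ (2 * tri j)), hs, Finset.sum_mul]
  exact Finset.sum_congr rfl fun n _ => by ring

theorem iterate_baileyOp_baileySum {q : ℂ} (hq0 : q ≠ 0) (hq : ‖q‖ < 1) (w : ℂ) (k : ℕ) :
    (baileyOp q)^[k] (baileySum q fun j => q ^ tri j * w ^ j) =
      baileySum q fun j => (q ^ (2 * k + 1)) ^ tri j * w ^ j := by
  induction k with
  | zero => simp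
  | succ k ih =>
    rw [Function.iterate_succ_apply', ih, baileyOp_baileySum hq0 hq]
    congr 1
    ext j
    rw [← mul_assoc, zpow_mul, ← mul_zpow]
    congr 2
    norm_cast
    ring

/-! ### Limits and the Jacobi triple product. -/

theorem summable_zpow_tri_mul_zpow {p w : ℂ} (hp0 : p ≠ 0) (hp : ‖p‖ < 1) (hw : w ≠ 0) :
    Summable fun j : ℤ => p ^ tri j * w ^ j := by
  have key : ∀ (f : ℕ → ℂ) (c : ℂ), (∀ n, f n ≠ 0) → (∀ n, f (n + 1) = c * p ^ n * f n) →
      Summable f := by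
    intro f c hf hrec
    refine summable_of_ratio_test_tendsto_lt_one (l := 0) zero_lt_one
      (Eventually.of_forall hf) ?_
    have h := ((tendsto_pow_atTop_nhds_zero_of_norm_lt_one hp).const_mul c).norm
    simp only [mul_zero, norm_zero] at h
    refine h.congr fun n => ?_
    rw [hrec, norm_mul _ (f n), mul_div_cancel_right₀ _ (norm_ne_zero_iff.2 (hf n))]
  refine Summable.of_nat_of_neg (key _ w ?_ ?_) (key _ (p / w) ?_ ?_)
  · exact fun n => mul_ne_zero (zpow_ne_zero _ hp0) (zpow_ne_zero _ hw)
  · intro n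
    push_cast
    rw [tri_add_one, zpow_add₀ hp0, zpow_add₀ hw, zpow_natCast, zpow_natCast, zpow_one]
    ring
  · exact fun n => mul_ne_zero (zpow_ne_zero _ hp0) (zpow_ne_zero _ hw)
  · intro n
    have e : tri (-((n + 1 : ℕ) : ℤ)) = tri (-n) + n + 1 := by
      have h := tri_sub_one (-n)
      push_cast
      rw [show (-(n + 1) : ℤ) = -n - 1 by ring, h]
      ring
    rw [e]
    push_cast
    rw [neg_add, ← sub_eq_add_neg (-(n : ℤ)), zpow_sub₀ hw, zpow_add₀ hp0, zpow_add₀ hp0,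
      zpow_natCast, zpow_one, zpow_one]
    field_simp

/-- Tannery's theorem for `∑ⱼ a(j) / ((q)_{n + j} (q)_{n + d - j})` as `n → ∞`. -/
theorem tendsto_tsum_mul_invPoch {q : ℂ} (hq : ‖q‖ < 1) {a : ℤ → ℂ} (ha : Summable a) (d : ℤ) :
    Tendsto (fun n : ℕ => ∑' j : ℤ, a j * (invPoch q (n + j) * invPoch q (n + d - j))) atTop
      (𝓝 ((∑' j, a j) * ((qPochInf q q)⁻¹ * (qPochInf q q)⁻¹))) := by
  obtain ⟨C, hC⟩ := exists_norm_invPoch_le hq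
  have ht := tendsto_invPoch hq (qPochInf_self_ne_zero hq)
  rw [← tsum_mul_right]
  refine tendsto_tsum_of_dominated_convergence (ha.norm.mul_right (C * C)) (fun j => ?_)
    (Eventually.of_forall fun n j => ?_)
  · refine ((ht.comp ?_).mul (ht.comp ?_)).const_mul _
    · exact tendsto_atTop_add_const_right _ _ tendsto_natCast_atTop_atTop
    · simp_rw [add_sub_assoc]
      exact tendsto_atTop_add_const_right _ _ tendsto_natCast_atTop_atTop
  · rw [norm_mul, norm_mul]
    gcongr
    · exact (norm_nonneg _).trans (hC 0)
    · exact hC _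
    · exact hC _

/-- The Jacobi triple product identity. -/
theorem tsum_zpow_tri_mul_zpow {p w : ℂ} (hp0 : p ≠ 0) (hp : ‖p‖ < 1) (hw : w ≠ 0) :
    ∑' j : ℤ, p ^ tri j * w ^ j =
      qPochInf (-w) p * qPochInf (-(p / w)) p * qPochInf p p := by
  have h1 := tendsto_tsum_mul_invPoch hp (summable_zpow_tri_mul_zpow hp0 hp hw) 0
  have hne := qPochInf_self_ne_zero hp
  have h2 : Tendsto (fun n : ℕ => qPoch (-w) p n * qPoch (-(p / w)) p n * invPoch p (n + n)) atTop
      (𝓝 (qPochInf (-w) p * qPochInf (-(p / w)) p * (qPochInf p p)⁻¹)) := by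
    refine ((tendsto_qPoch _ hp).mul (tendsto_qPoch _ hp)).mul ((tendsto_invPoch hp hne).comp ?_)
    exact tendsto_natCast_atTop_atTop.atTop_add_atTop tendsto_natCast_atTop_atTop
  -- The limit of the series carries (p)_∞⁻² and that of the product (p)_∞⁻¹, which leaves one
  -- factor (p)_∞.
  have h3 := tendsto_nhds_unique h1 (h2.congr fun n => ?_)
  · field_simp at h3
    linear_combination h3
  · rw [add_zero]
    exact (hasSum_finite_triple_product hp0 hp hw n n).tsum_eq.symm

/-- The limit of `baileyOp q (baileySum q a) M` as M → ∞ is computed twice: termwise in n, and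
through `baileyOp_baileySum`. One factor 1/(q)_∞ cancels. -/
theorem tsum_mul_baileySum {q : ℂ} (hq0 : q ≠ 0) (hq : ‖q‖ < 1) {a : ℤ → ℂ} (ha : Summable a)
    (ha' : Summable fun j => q ^ (2 * tri j) * a j) :
    ∑' n : ℕ, q ^ (n ^ 2 + n) * baileySum q a n =
      (∑' j, q ^ (2 * tri j) * a j) / qPochInf q q := by
  have hne := qPochInf_self_ne_zero hq
  obtain ⟨C, hC⟩ := exists_norm_invPoch_le hq
  obtain ⟨D, hD⟩ := (tendsto_tsum_mul_invPoch hq ha 1).norm.bddAbove_range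
  have h1 := tendsto_tsum_mul_invPoch hq ha' 1
  have h2 : Tendsto (baileyOp q (baileySum q a)) atTop
      (𝓝 (∑' n : ℕ, q ^ (n ^ 2 + n) * (qPochInf q q)⁻¹ * baileySum q a n)) := by
    refine tendsto_tsum_of_dominated_convergence
      (bound := fun n => ‖q‖ ^ n * C * D) ?_ (fun n => ?_) (Eventually.of_forall fun M n => ?_)
    · exact ((summable_geometric_of_lt_one (norm_nonneg q) hq).mul_right _).mul_right _
    · refine (((tendsto_invPoch hq hne).comp ?_).const_mul _).mul_const _
      exact tendsto_atTop_add_const_right _ _ tendsto_natCast_atTop_atTop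
    · rw [norm_mul, norm_mul, norm_pow]
      have hC0 : 0 ≤ C := (norm_nonneg _).trans (hC 0)
      refine mul_le_mul (mul_le_mul ?_ (hC _) (norm_nonneg _) (by positivity)) (hD ⟨n, rfl⟩)
        (norm_nonneg _) (by positivity)
      exact pow_le_pow_of_le_one (norm_nonneg q) hq.le (Nat.le_add_left _ _)
  rw [baileyOp_baileySum hq0 hq] at h2
  have h3 := tendsto_nhds_unique h2 h1
  simp_rw [mul_right_comm _ (qPochInf q q)⁻¹, tsum_mul_right] at h3
  field_simp at h3 ⊢
  exact h3

/-! ### The multisum as an iterated operator. -/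

/-- The multisum term with general last factor `f`, on all sequences (it vanishes off chains). -/
noncomputable def chainTerm (q : ℂ) (f : ℕ → ℂ) (k : ℕ) (s : Fin (k + 1) → ℕ) : ℂ :=
  (∏ i, q ^ (s i ^ 2 + s i)) * (∏ i : Fin k, invPoch q (s i.castSucc - s i.succ)) *
    f (s (Fin.last k))

theorem chainTerm_cons (q : ℂ) (f : ℕ → ℂ) (k n : ℕ) (t : Fin (k + 1) → ℕ) :
    chainTerm q f (k + 1) (Fin.cons n t) =
      q ^ (n ^ 2 + n) * (invPoch q (n - t 0) * chainTerm q f k t) := by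
  set s : Fin (k + 2) → ℕ := Fin.cons n t
  have h0 : s 0 = n := rfl
  have h1 : ∀ i : Fin (k + 1), s i.succ = t i := fun i => rfl
  rw [chainTerm, Fin.prod_univ_succ fun i : Fin (k + 1) => invPoch q (s i.castSucc - s i.succ),
    Fin.prod_univ_succ fun i => q ^ (s i ^ 2 + s i), chainTerm, ← Fin.succ_last]
  simp only [Fin.castSucc_zero, ← Fin.succ_castSucc, h0, h1]
  ring

theorem summable_pi_prod_of_nonneg {ι : Type*} [Fintype ι] {r : ℕ → ℝ} (hr : Summable r)
    (h0 : ∀ n, 0 ≤ r n) : Summable fun s : ι → ℕ => ∏ i, r (s i) := by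
  classical
  refine summable_of_sum_le (c := ∏ _i : ι, ∑' n, r n)
    (fun s => Finset.prod_nonneg fun i _ => h0 _) fun u => ?_
  calc ∑ s ∈ u, ∏ i, r (s i)
      ≤ ∑ s ∈ Fintype.piFinset fun i => u.image fun s => s i, ∏ i, r (s i) := by
        refine Finset.sum_le_sum_of_subset_of_nonneg (fun s hs => ?_)
          fun s _ _ => Finset.prod_nonneg fun i _ => h0 _
        exact Fintype.mem_piFinset.2 fun i => Finset.mem_image_of_mem _ hs
    _ = ∏ i, ∑ n ∈ u.image fun s => s i, r n :=
        (Finset.prod_univ_sum _ _).symm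
    _ ≤ ∏ _i : ι, ∑' n, r n :=
        Finset.prod_le_prod (fun i _ => Finset.sum_nonneg fun n _ => h0 n)
          fun i _ => hr.sum_le_tsum _ fun n _ => h0 n

theorem summable_chainTerm {q : ℂ} (hq : ‖q‖ < 1) {f g : ℕ → ℂ} {A B : ℝ}
    (hf : ∀ n, ‖f n‖ ≤ A) (hg : ∀ n, ‖g n‖ ≤ B) (k : ℕ) :
    Summable fun s : Fin (k + 1) → ℕ => g (s 0) * chainTerm q f k s := by
  obtain ⟨C, hC⟩ := exists_norm_invPoch_le hq
  have hA : 0 ≤ A := (norm_nonneg _).trans (hf 0)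
  have hB : 0 ≤ B := (norm_nonneg _).trans (hg 0)
  have hC0 : 0 ≤ C := (norm_nonneg _).trans (hC 0)
  refine Summable.of_norm_bounded (g := fun s => B * ((∏ i, ‖q‖ ^ s i) * C ^ k * A))
    (((summable_pi_prod_of_nonneg (summable_geometric_of_lt_one (norm_nonneg q) hq)
      fun n => by positivity).mul_right _).mul_right _ |>.mul_left _) fun s => ?_
  unfold chainTerm
  rw [norm_mul, norm_mul, norm_mul, norm_prod, norm_prod]
  have h1 : ∏ i, ‖q ^ (s i ^ 2 + s i)‖ ≤ ∏ i, ‖q‖ ^ s i := by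
    refine Finset.prod_le_prod (fun i _ => norm_nonneg _) fun i _ => ?_
    rw [norm_pow]
    exact pow_le_pow_of_le_one (norm_nonneg q) hq.le (Nat.le_add_left _ _)
  have h2 : ∏ i : Fin k, ‖invPoch q (s i.castSucc - s i.succ)‖ ≤ C ^ k := by
    refine (Finset.prod_le_prod (fun i _ => norm_nonneg _) fun i _ => hC _).trans_eq ?_
    simp
  gcongr
  · exact hg _
  · exact hf _

/-- The weight `g` on the first variable makes the induction close: fixing s_1 = n leaves the
shorter multisum with weight 1/(q)_{n - s_2}. -/
theorem hasSum_chainTerm {q : ℂ} (hq : ‖q‖ < 1) {f : ℕ → ℂ} {A : ℝ} (hf : ∀ n, ‖f n‖ ≤ A)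
    (k : ℕ) {g : ℕ → ℂ} {B : ℝ} (hg : ∀ n, ‖g n‖ ≤ B) :
    HasSum (fun s : Fin (k + 1) → ℕ => g (s 0) * chainTerm q f k s)
      (∑' n : ℕ, g n * (q ^ (n ^ 2 + n) * (baileyOp q)^[k] f n)) := by
  have hs := (summable_chainTerm hq hf hg k).hasSum
  convert hs using 1
  induction k generalizing g B with
  | zero =>
    rw [← (Equiv.funUnique (Fin 1) ℕ).symm.tsum_eq]
    simp [chainTerm]
  | succ k ih =>
    obtain ⟨C, hC⟩ := exists_norm_invPoch_le hq
    rw [← (Fin.consEquiv fun _ : Fin (k + 2) => ℕ).hasSum_iff] at hs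
    have h := hs.prod_fiberwise (g := fun n : ℕ =>
      g n * (q ^ (n ^ 2 + n) * (baileyOp q)^[k + 1] f n)) fun n => ?_
    · exact h.tsum_eq
    · have hn : ∀ m : ℕ, ‖invPoch q (n - m)‖ ≤ C := fun m => hC _
      have h1 := (summable_chainTerm hq hf hn k).hasSum
      rw [← ih hn h1] at h1
      have h2 := (h1.mul_left (q ^ (n ^ 2 + n))).mul_left (g n)
      have e : ∑' m : ℕ, invPoch q (n - m) * (q ^ (m ^ 2 + m) * (baileyOp q)^[k] f m) =
          (baileyOp q)^[k + 1] f n := by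
        rw [Function.iterate_succ_apply', baileyOp]
        exact tsum_congr fun m => by ring
      rw [e] at h2
      refine (congrArg (HasSum · _) (funext fun t => ?_)).mpr h2
      exact congrArg (g n * ·) (chainTerm_cons q f k n t)

theorem chainTerm_eq_zero {q : ℂ} (f : ℕ → ℂ) {k : ℕ} {s : Fin (k + 1) → ℕ} (hs : ¬Antitone s) :
    chainTerm q f k s = 0 := by
  rw [Fin.antitone_iff_succ_le] at hs
  push Not at hs
  obtain ⟨i, hi⟩ := hs
  rw [chainTerm, Finset.prod_eq_zero (Finset.mem_univ i) (invPoch_of_neg q (by omega))]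
  simp

theorem chainTerm_eq_oddTerm {k : ℕ} {q z : ℂ} (hq0 : q ≠ 0) (s : Chain k) :
    chainTerm q (fun n => qPoch (-(z * q ^ (k + 1))) q (n + 1) *
      qPoch (-(q / (z * q ^ (k + 1)))) q n * invPoch q (n + (n + 1 : ℕ))) k s.1 =
      oddTerm k q z s := by
  have e : q / (z * q ^ (k + 1)) = q ^ (-(k : ℤ)) / z := by
    rw [zpow_neg, zpow_natCast, pow_succ]
    field_simp
  have e2 : ∀ n : ℕ, invPoch q (n + (n + 1 : ℕ)) = (qPoch q q (2 * n + 1))⁻¹ := fun n => by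
    rw [← invPoch_natCast]
    congr 1
    push_cast
    ring
  have e3 : ∀ i : Fin k, invPoch q (s.1 i.castSucc - s.1 i.succ) =
      (qPoch q q (s.1 i.castSucc - s.1 i.succ))⁻¹ := fun i => by
    rw [← invPoch_natCast, Nat.cast_sub (s.2 (Fin.castSucc_lt_succ).le)]
  rw [chainTerm, oddTerm, Finset.prod_pow_eq_pow_sum, e, e2]
  simp_rw [e3, Finset.prod_inv_distrib]
  simp only [div_eq_mul_inv]

theorem mainTheorem7 (k : ℕ) (q z : ℂ) (hq0 : q ≠ 0) (hq : ‖q‖ < 1) (hz : z ≠ 0) :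
    HasSum (oddTerm k q z)
      (qPochInf (-(z * q ^ (k + 1))) (q ^ (2 * k + 3)) *
          qPochInf (-(q ^ (k + 2) / z)) (q ^ (2 * k + 3)) *
          qPochInf (q ^ (2 * k + 3)) (q ^ (2 * k + 3)) /
        qPochInf q q) := by
  set w := z * q ^ (k + 1) with hw_def
  have hw : w ≠ 0 := mul_ne_zero hz (pow_ne_zero _ hq0)
  have hpow : ∀ n : ℕ, ‖q ^ (n + 1)‖ < 1 := fun n => by
    rw [norm_pow]
    exact pow_lt_one₀ (norm_nonneg q) hq n.succ_ne_zero
  set f : ℕ → ℂ := fun n =>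
    qPoch (-w) q (n + 1) * qPoch (-(q / w)) q n * invPoch q (n + (n + 1 : ℕ))
  -- The sizes n and n + 1 account for the odd index 2n + 1 in the denominator.
  have hfB : f = baileySum q fun j => q ^ tri j * w ^ j := by
    ext n
    refine (hasSum_finite_triple_product hq0 hq hw n (n + 1)).tsum_eq.symm.trans ?_
    push_cast
    rfl
  obtain ⟨A, hA⟩ : ∃ A, ∀ n, ‖f n‖ ≤ A := by
    obtain ⟨A, hA⟩ :=
      (tendsto_tsum_mul_invPoch hq (summable_zpow_tri_mul_zpow hq0 hq hw) 1).norm.bddAbove_range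
    exact ⟨A, fun n => hfB ▸ hA ⟨n, rfl⟩⟩
  have hsum := hasSum_chainTerm hq hA k (g := fun _ => 1) (B := 1) (by simp)
  simp only [one_mul] at hsum
  have ha : ∀ j : ℤ, q ^ (2 * tri j) * ((q ^ (2 * k + 1)) ^ tri j * w ^ j) =
      (q ^ (2 * k + 3)) ^ tri j * w ^ j := fun j => by
    rw [← mul_assoc, zpow_mul, ← mul_zpow]
    congr 2
    norm_cast
    ring
  have hs3 := summable_zpow_tri_mul_zpow (pow_ne_zero _ hq0) (hpow (2 * k + 2)) hw
  rw [hfB, iterate_baileyOp_baileySum hq0 hq, tsum_mul_baileySum hq0 hq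
    (summable_zpow_tri_mul_zpow (pow_ne_zero _ hq0) (hpow (2 * k)) hw) (by simpa only [ha] using hs3),
    ← hfB] at hsum
  simp_rw [ha] at hsum
  rw [tsum_zpow_tri_mul_zpow (pow_ne_zero _ hq0) (hpow (2 * k + 2)) hw] at hsum
  have e : q ^ (2 * k + 3) / w = q ^ (k + 2) / z := by
    rw [hw_def, show 2 * k + 3 = (k + 2) + (k + 1) by ring, pow_add]
    field_simp
  -- Terms off the chains vanish, so the sum over all sequences restricts to `Chain k`.
  rw [e, ← Subtype.val_injective.hasSum_iff (g := (Subtype.val : Chain k → _))] at hsum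
  · exact (congrArg (HasSum · _) (funext fun s => chainTerm_eq_oddTerm hq0 s)).mp hsum
  · intro s hs
    exact chainTerm_eq_zero f fun h => hs ⟨⟨s, h⟩, rfl⟩
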